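/- Let $R_1,R_2>0$ and equip $\mathcal M=\mathbb S^2\times\mathbb S^2\subset\mathbb R^3\times\mathbb R^3$, with Cartesian coordinates $(x_i,y_i,z_i)$ on the $i$-th unit sphere, with the symplectic form $\omega=R_1\,\omega_{\mathbb S^2}\oplus R_2\,\omega_{\mathbb S^2}$, where $\omega_{\mathbb S^2}$ is the standard area form ($=dx\wedge dy/z$ where $z\neq0$). Let $t_1,t_2,t_3\in\mathbb R$, and consider the rational Gaudin model $$H_{t_4}=t_1z_1+t_2z_2+t_3(x_1x_2+y_1y_2)+t_4z_1z_2,\qquad t_4\in\mathbb R,$$ the point $m_0=(0,0,1,0,0,-1)$ and the parameter value $$t_{4,m_0}^+=\frac{t_1R_2-t_2R_1+2t_3\sqrt{R_1R_2}}{R_1+R_2}.$$ Definitions. Canonical coordinates $(q_1,q_2,p_1,p_2)$ at $m_0$ are smooth local coordinates of $\mathcal M$, centred at $m_0$, in which $\omega=dq_1\wedge dp_1+dq_2\wedge dp_2$. Put $S=q_1p_2-q_2p_1$, $M=\frac12(q_1^2+q_2^2)$, $N=\frac12(p_1^2+p_2^2)$. A family $H_t$ undergoes a *subcritical Hamiltonian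 Hopf bifurcation* at $m_0$ and $t=t^*$ if there are $\rho\in\mathbb R\setminus\{0\}$, $\sigma\in\{1,-1\}$ and $a\in\mathbb R$ such that * (linear bifurcation) in suitable canonical coordinates at $m_0$, followed for each $t$ in an open interval $I\ni t^*$ by a linear symplectic change of coordinates depending smoothly on $t$, the Taylor expansion of $H_t$ at $m_0$ is $$H_t(m_0)+(\rho+\nu_1(t))S+\sigma M-\nu_2(t)N+(\text{terms of order}\ge3),\qquad t\in I,$$ where $\nu_1,\nu_2:I\to\mathbb R$ are smooth, $\nu_1(t^*)=\nu_2(t^*)=0$ and $\nu_2'(t^*)\neq0$; * (nonlinear normal form) in suitable canonical coordinates at $m_0$, $$H_{t^*}=H_{t^*}(m_0)+\rho S+\sigma N+aM^2+bMS+cS^2+(\text{terms of order}\ge5)$$ for some $b,c\in\mathbb R$; * $\sigma a<0$. Statement. Assume $(t_1+t_2)\sqrt{R_1R_2}+t_3(R_1-R_2)\neq0$. Then $m_0$ undergoes a subcritical Hamiltonian Hopf bifurcation at $t_4=t_{4,m_0}^+$ if one of the following holds: 1. (i) $R_1=R_2$, and either $t_1<t_2$ and $t_3<0$, or $t_1>t_2$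 and $t_3>0$; 2. (ii) $(R_1-R_2)^2t_3>-2\sqrt{R_1R_2}\,(R_1t_2-R_2t_1)$ and $t_3<0$; 3. (iii) $(R_1-R_2)^2t_3<-2\sqrt{R_1R_2}\,(R_1t_2-R_2t_1)$ and $t_3>0$. Moreover, one of (i), (ii), (iii) holds if and only if $t_3\neq0$ and $$a_3:=\frac{2R_1R_2(R_1t_2-R_2t_1)+(R_1-R_2)^2\sqrt{R_1R_2}\,t_3}{8(R_1R_2)^{3/2}(R_1+R_2)t_3}<0 .$$ -/

import Mathlib

open scoped ContDiff

noncomputable section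

namespace Gaudin

/-! ### The phase space -/

/-- Ambient space of one sphere, with Cartesian coordinates `(x, y, z) = (u 0, u 1, u 2)`. -/
abbrev R3 : Type := Fin 3 → ℝ

/-- `ℝ⁴` with coordinates `(q₁, q₂, p₁, p₂) = (x 0, x 1, x 2, x 3)`. -/
abbrev R4 : Type := Fin 4 → ℝ

/-- The product of two unit spheres `S² × S²` inside `ℝ³ × ℝ³`. -/
def M : Set (R3 × R3) := {m | dotProduct m.1 m.1 = 1 ∧ dotProduct m.2 m.2 = 1}

/-- The symplectic form `R₁ ω_{S²} ⊕ R₂ ω_{S²}` on `S² × S²` at the point `m`. The area form of the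
unit sphere at `u` is `(a, b) ↦ det (u, a, b) = u ⬝ (a × b)` on tangent vectors `a`, `b`; where
`z ≠ 0` it equals `dx ∧ dy / z`. -/
def omega (R₁ R₂ : ℝ) (m a b : R3 × R3) : ℝ :=
  R₁ * dotProduct m.1 (crossProduct a.1 b.1) + R₂ * dotProduct m.2 (crossProduct a.2 b.2)

/-- The standard symplectic form `dq₁ ∧ dp₁ + dq₂ ∧ dp₂` on `ℝ⁴`. -/
def omegaStd (v w : R4) : ℝ :=
  (v 0 * w 2 - v 2 * w 0) + (v 1 * w 3 - v 3 * w 1)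

/-- `φ` gives canonical (Darboux) coordinates of `(S² × S², R₁ ω_{S²} ⊕ R₂ ω_{S²})` around `z₀`:
it is a smooth injective parametrization, defined on an open neighbourhood `U` of `0` in `ℝ⁴`, with
values in `S² × S²`, which sends `0` to `z₀` and pulls the symplectic form back to the standard one.
(As the standard form is nondegenerate, `φ` is then an immersion between manifolds of
dimension four, hence a diffeomorphism of `U` onto an open subset of `S² × S²`.) -/
structure IsCanonicalChart (R₁ R₂ : ℝ) (z₀ : R3 × R3) (U : Set R4) (φ : R4 → R3 × R3) : Prop where
  isOpen : IsOpen U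
  zero_mem : (0 : R4) ∈ U
  smooth : ContDiffOn ℝ ∞ φ U
  injOn : Set.InjOn φ U
  mapsTo : Set.MapsTo φ U M
  map_zero : φ 0 = z₀
  pullback : ∀ x ∈ U, ∀ v w : R4,
    omega R₁ R₂ (φ x) (fderiv ℝ φ x v) (fderiv ℝ φ x w) = omegaStd v w

/-! ### The Hilbert generators -/

/-- `S = q₁ p₂ - q₂ p₁`. -/
def genS (x : R4) : ℝ := x 0 * x 3 - x 1 * x 2

/-- `M = (q₁² + q₂²) / 2`. -/
def genM (x : R4) : ℝ := (x 0 ^ 2 + x 1 ^ 2) / 2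

/-- `N = (p₁² + p₂²) / 2`. -/
def genN (x : R4) : ℝ := (x 2 ^ 2 + x 3 ^ 2) / 2

/-! ### Hamiltonian Hopf bifurcations on `S² × S²` -/

/-- The family of Hamiltonians `H t` goes through a linear Hamiltonian Hopf bifurcation at `z₀` and
`t = t₀`, with quadratic normal form `ρ S + σ M`. That is: in canonical coordinates at `z₀`, followed
by a linear symplectic change of coordinates `P t` depending smoothly on `t`, the Taylor
expansion of `H t` at `z₀` is, for all `t` in an open interval around `t₀`,
`H t z₀ + (ρ + ν₁ t) S + σ M - (ν₂ t) N + (terms of order at least three)`, where `ν₁`, `ν₂` are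
smooth functions that vanish at `t₀` and `ν₂' (t₀) ≠ 0` (transversality). -/
def IsLinearHHB (R₁ R₂ : ℝ) (H : ℝ → R3 × R3 → ℝ) (z₀ : R3 × R3) (t₀ ρ σ : ℝ) : Prop :=
  ∃ (U : Set R4) (φ : R4 → R3 × R3) (δ : ℝ) (P : ℝ → R4 →L[ℝ] R4) (ν₁ ν₂ : ℝ → ℝ),
    IsCanonicalChart R₁ R₂ z₀ U φ ∧
    0 < δ ∧
    ContDiffOn ℝ ∞ P (Set.Ioo (t₀ - δ) (t₀ + δ)) ∧
    ContDiffOn ℝ ∞ ν₁ (Set.Ioo (t₀ - δ) (t₀ + δ)) ∧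
    ContDiffOn ℝ ∞ ν₂ (Set.Ioo (t₀ - δ) (t₀ + δ)) ∧
    ν₁ t₀ = 0 ∧ ν₂ t₀ = 0 ∧ deriv ν₂ t₀ ≠ 0 ∧
    ∀ t ∈ Set.Ioo (t₀ - δ) (t₀ + δ),
      (∀ v w : R4, omegaStd (P t v) (P t w) = omegaStd v w) ∧
      (fun x : R4 => H t (φ (P t x)) - H t z₀
          - ((ρ + ν₁ t) * genS x + σ * genM x - ν₂ t * genN x))
        =o[nhds 0] fun x : R4 => ‖x‖ ^ 2

/-- At `z₀` the Hamiltonian `h` has, up to second order in the Hilbert generators (that is, up to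
fourth order in canonical coordinates), the normal form `ρ S + σ N + a M² + b M S + c S²`, up to the
constant `h z₀`; `a` is the coefficient of `M²`. -/
def HasHopfNormalForm (R₁ R₂ : ℝ) (h : R3 × R3 → ℝ) (z₀ : R3 × R3) (ρ σ a : ℝ) : Prop :=
  ∃ (U : Set R4) (φ : R4 → R3 × R3) (b c : ℝ),
    IsCanonicalChart R₁ R₂ z₀ U φ ∧
    (fun x : R4 => h (φ x) - h z₀
        - (ρ * genS x + σ * genN x
            + (a * genM x ^ 2 + b * (genM x * genS x) + c * genS x ^ 2)))
      =o[nhds 0] fun x : R4 => ‖x‖ ^ 4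

/-- The family of Hamiltonians `H t` goes through a subcritical Hamiltonian Hopf bifurcation at `z₀`
and `t = t₀`: it goes through a linear Hamiltonian Hopf bifurcation, and the nonlinear normal form
`ρ S + σ N + a M² + ⋯` of `H t₀` at `z₀` satisfies `σ a < 0`; here `ρ ≠ 0` and `σ = ±1`. (The
symplectic map `(q, p) ↦ (p, -q)` exchanges `M` and `N` and fixes `S`, so the quadratic parts
`ρ S + σ M` and `ρ S + σ N` are the same up to the choice of canonical coordinates.) -/
def IsSubcriticalHHB (R₁ R₂ : ℝ) (H : ℝ → R3 × R3 → ℝ) (z₀ : R3 × R3) (t₀ : ℝ) : Prop :=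
  ∃ ρ σ a : ℝ, ρ ≠ 0 ∧ (σ = 1 ∨ σ = -1) ∧
    IsLinearHHB R₁ R₂ H z₀ t₀ ρ σ ∧
    HasHopfNormalForm R₁ R₂ (H t₀) z₀ ρ σ a ∧
    σ * a < 0

/-! ### The Gaudin model -/

/-- The Hamiltonian
`t₀ (z₁ + z₂)² + w (t₁ z₁ + t₂ z₂) + t₃ (x₁ x₂ + y₁ y₂) + t₄ z₁ z₂`. -/
def hamiltonian (w t₀ t₁ t₂ t₃ t₄ : ℝ) (m : R3 × R3) : ℝ :=
  t₀ * (m.1 2 + m.2 2) ^ 2 + w * (t₁ * m.1 2 + t₂ * m.2 2)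
    + t₃ * (m.1 0 * m.2 0 + m.1 1 * m.2 1) + t₄ * (m.1 2 * m.2 2)

/-- The point `m₀ = (0, 0, 1, 0, 0, -1)`. -/
def m₀ : R3 × R3 := (![0, 0, 1], ![0, 0, -1])

/-- The bifurcation value `t_{4,m₀}^+`. -/
def t4plus (R₁ R₂ w t₁ t₂ t₃ : ℝ) : ℝ :=
  (w * (t₁ * R₂ - t₂ * R₁) + 2 * t₃ * √(R₁ * R₂)) / (R₁ + R₂)

/-- The expression `a₃`, whose sign decides between sub- and supercritical bifurcations. -/
def a₃ (R₁ R₂ w t₀ t₁ t₂ t₃ : ℝ) : ℝ :=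
  (2 * (R₁ - R₂) ^ 2 * (R₁ + R₂) * t₀ + 2 * (R₁ * R₂) * w * (R₁ * t₂ - R₂ * t₁)
      + (R₁ - R₂) ^ 2 * √(R₁ * R₂) * t₃)
    / (8 * √(R₁ * R₂) ^ 3 * (R₁ + R₂) * t₃)

end Gaudin

end

noncomputable section

namespace Gaudin

open Asymptotics Filter Topology

/-! ### A Darboux chart -/

/-! In equal-area coordinates on each sphere, scaled by `√Rᵢ`, the Hamiltonian is even. With `Jᵢ =
(qᵢ² + pᵢ²)/2` and `K = q₁q₂ - p₁p₂`, its quadratic part is `α J₁ + β J₂ + γ K`, where `γ =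
t₃/√(R₁R₂)` and `α`, `β` are affine in `t₄`; the quartic part is again a polynomial in `J₁`, `J₂`,
`K` (`hamiltonian_expansion`).

A linear symplectic map sends `J₂ - J₁` to `S`, and `J₁ + J₂`, `K` to the sum and difference of
multiples of `N` and `M` (`action_hopfMap`). The coefficient of `M` is then proportional to `(α +
β)/2 - γ`. It vanishes at `t_{4,m₀}^+` and crosses zero with nonzero speed, which is the linear
bifurcation. What remains there is `ρ S + σ N` with `σ` the sign of `t₃`; `ρ ≠ 0` is the standing
hypothesis.

There are no cubic terms, so the nonlinear normal form takes a single quartic Birkhoff step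
(`exists_normalization`). It removes `N²` and `NS`, turns `MN` into a multiple of `S²`, and leaves
the coefficient `a` of `M²` unchanged, so `a` is read off the expansion. The normalizing map need
not be a Hamiltonian flow: every quartic form is a sum of fourth powers of linear forms, whose flows
are explicit polynomial shears, and a composition of these has the required third order jet
(`prodField_mem`, `exists_isSymplecticMap`).

Finally `σ a` has the sign of a single polynomial in the parameters, and so do `a₃` and conditions
(i)–(iii). -/

/-- Area preserving parametrization of the unit sphere around the pole `(0, 0, s)`, `s = ±1`. -/
def cap (s a b : ℝ) : R3 :=
  ![√(1 - (a ^ 2 + b ^ 2) / 4) * a, s * (√(1 - (a ^ 2 + b ^ 2) / 4) * b),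
    s * (1 - (a ^ 2 + b ^ 2) / 2)]

lemma dotProduct_cap {s a b : ℝ} (hs : s ^ 2 = 1) (h : a ^ 2 + b ^ 2 < 4) :
    dotProduct (cap s a b) (cap s a b) = 1 := by
  have h0 : 0 < 1 - (a ^ 2 + b ^ 2) / 4 := by linarith
  have hg := Real.sq_sqrt h0.le
  simp only [dotProduct, cap, Fin.sum_univ_three, Matrix.cons_val]
  set g := √(1 - (a ^ 2 + b ^ 2) / 4)
  linear_combination (a ^ 2 + b ^ 2 * s ^ 2) * hg
    + (b ^ 2 * (1 - (a ^ 2 + b ^ 2) / 4) + (1 - (a ^ 2 + b ^ 2) / 2) ^ 2) * hs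

lemma cap_injective {s a b a' b' : ℝ} (hs : s ^ 2 = 1) (h : a ^ 2 + b ^ 2 < 4)
    (e : cap s a b = cap s a' b') : a = a' ∧ b = b' := by
  have hs0 : s ≠ 0 := by rintro rfl; norm_num at hs
  have e0 := congrFun e 0
  have e1 := congrFun e 1
  have e2 := congrFun e 2
  simp only [cap, Matrix.cons_val] at e0 e1 e2
  have e2' := mul_left_cancel₀ hs0 e2
  have hr : a' ^ 2 + b' ^ 2 = a ^ 2 + b ^ 2 := by linarith
  rw [hr] at e0 e1
  have hg : √(1 - (a ^ 2 + b ^ 2) / 4) ≠ 0 :=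
    (Real.sqrt_pos.2 (by linarith)).ne'
  exact ⟨mul_left_cancel₀ hg e0, mul_left_cancel₀ hg (mul_left_cancel₀ hs0 e1)⟩

lemma hasFDerivAt_cap {E : Type*} [NormedAddCommGroup E] [NormedSpace ℝ E] {f g : E → ℝ}
    {f' g' : E →L[ℝ] ℝ} {x : E} (s : ℝ) (hf : HasFDerivAt f f' x) (hg : HasFDerivAt g g' x)
    (h : f x ^ 2 + g x ^ 2 < 4) :
    ∃ c' : E →L[ℝ] R3, HasFDerivAt (fun y => cap s (f y) (g y)) c' x ∧
      ∀ v, c' v =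
        ![-(f x * f' v + g x * g' v) / (4 * √(1 - (f x ^ 2 + g x ^ 2) / 4)) * f x
            + √(1 - (f x ^ 2 + g x ^ 2) / 4) * f' v,
          s * (-(f x * f' v + g x * g' v) / (4 * √(1 - (f x ^ 2 + g x ^ 2) / 4)) * g x
            + √(1 - (f x ^ 2 + g x ^ 2) / 4) * g' v),
          s * -(f x * f' v + g x * g' v)] := by
  have h0 : 0 < 1 - (f x ^ 2 + g x ^ 2) / 4 := by linarith
  have hs0 := (Real.sqrt_pos.2 h0).ne'
  have hr : HasFDerivAt (fun y => f y ^ 2 + g y ^ 2) ((2 * f x) • f' + (2 * g x) • g') x := by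
    have := (hf.pow 2).add (hg.pow 2)
    simp only [Nat.add_one_sub_one, pow_one, nsmul_eq_mul, Nat.cast_ofNat] at this
    exact this
  have hr4 : HasFDerivAt (fun y => 1 - (f y ^ 2 + g y ^ 2) / 4)
      (-((4 : ℝ)⁻¹ • ((2 * f x) • f' + (2 * g x) • g'))) x := by
    simp only [div_eq_mul_inv]
    exact (hr.mul_const (4 : ℝ)⁻¹).const_sub 1
  have hr2 : HasFDerivAt (fun y => 1 - (f y ^ 2 + g y ^ 2) / 2)
      (-((2 : ℝ)⁻¹ • ((2 * f x) • f' + (2 * g x) • g'))) x := by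
    simp only [div_eq_mul_inv]
    exact (hr.mul_const (2 : ℝ)⁻¹).const_sub 1
  have hq : HasFDerivAt (fun y => √(1 - (f y ^ 2 + g y ^ 2) / 4)) _ x :=
    hr4.sqrt h0.ne'
  have h1 := hq.mul hf
  have h2 := (hq.mul hg).const_mul s
  have h3 := hr2.const_mul s
  have key : ∀ a b c : E →L[ℝ] ℝ,
      HasFDerivAt (fun y => √(1 - (f y ^ 2 + g y ^ 2) / 4) * f y) a x →
      HasFDerivAt (fun y => s * (√(1 - (f y ^ 2 + g y ^ 2) / 4) * g y)) b x →
      HasFDerivAt (fun y => s * (1 - (f y ^ 2 + g y ^ 2) / 2)) c x →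
      HasFDerivAt (fun y => cap s (f y) (g y)) (ContinuousLinearMap.pi ![a, b, c]) x := by
    intro a b c ha hb hc
    rw [hasFDerivAt_pi']
    intro i
    fin_cases i
    · exact ha
    · exact hb
    · exact hc
  refine ⟨_, key _ _ _ h1 h2 h3, ?_⟩
  intro v
  ext i
  fin_cases i <;> simp <;> field_simp <;> ring

/-- This is the equal-area property of Lambert's azimuthal projection. The two vectors are the
tangent vectors produced by `hasFDerivAt_cap`. The factor `s` on both the second and third
coordinates makes `cap` at the south pole a rotation of the one at the north pole, so orientation is
kept. -/
lemma area_cap {s a b : ℝ} (hs : s ^ 2 = 1) (h : a ^ 2 + b ^ 2 < 4) (α β α' β' : ℝ) :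
    dotProduct (cap s a b) (crossProduct
      ![-(a * α + b * β) / (4 * √(1 - (a ^ 2 + b ^ 2) / 4)) * a + √(1 - (a ^ 2 + b ^ 2) / 4) * α,
        s * (-(a * α + b * β) / (4 * √(1 - (a ^ 2 + b ^ 2) / 4)) * b
          + √(1 - (a ^ 2 + b ^ 2) / 4) * β), s * -(a * α + b * β)]
      ![-(a * α' + b * β') / (4 * √(1 - (a ^ 2 + b ^ 2) / 4)) * a
          + √(1 - (a ^ 2 + b ^ 2) / 4) * α',
        s * (-(a * α' + b * β') / (4 * √(1 - (a ^ 2 + b ^ 2) / 4)) * b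
          + √(1 - (a ^ 2 + b ^ 2) / 4) * β'), s * -(a * α' + b * β')])
      = α * β' - α' * β := by
  have h0 : 0 < 1 - (a ^ 2 + b ^ 2) / 4 := by linarith
  have hg := Real.sq_sqrt h0.le
  have hg0 := (Real.sqrt_pos.2 h0).ne'
  simp only [dotProduct, cap, cross_apply, Fin.sum_univ_three, Matrix.cons_val]
  set g := √(1 - (a ^ 2 + b ^ 2) / 4)
  have hi : (4 * g)⁻¹ * g = 1 / 4 := by field_simp
  simp only [div_eq_mul_inv]
  set k := (4 * g)⁻¹
  linear_combination (α * β' - α' * β) *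
    ((g ^ 2 * (a ^ 2 + b ^ 2)
        + (1 - (a ^ 2 + b ^ 2) / 2) * (g ^ 2 - (k * g) * (a ^ 2 + b ^ 2))) * hs
      + (1 + (a ^ 2 + b ^ 2) / 2) * hg
      - (1 - (a ^ 2 + b ^ 2) / 2) * (a ^ 2 + b ^ 2) * hi)

/-- Darboux chart of `S² × S²` at `m₀`, for the areas `r₁ ^ 2` and `r₂ ^ 2`. -/
def baseChart (r₁ r₂ : ℝ) (x : R4) : R3 × R3 :=
  (cap 1 (x 0 / r₁) (x 2 / r₁), cap (-1) (x 1 / r₂) (x 3 / r₂))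

/-- Domain of `baseChart`. -/
def baseDomain (r₁ r₂ : ℝ) : Set R4 :=
  {x | (x 0 / r₁) ^ 2 + (x 2 / r₁) ^ 2 < 4 ∧ (x 1 / r₂) ^ 2 + (x 3 / r₂) ^ 2 < 4}

lemma hasFDerivAt_coord_div (i : Fin 4) (r : ℝ) (x : R4) :
    HasFDerivAt (fun y : R4 => y i / r)
      (r⁻¹ • (ContinuousLinearMap.proj i : R4 →L[ℝ] ℝ)) x := by
  simp only [div_eq_inv_mul]
  exact (ContinuousLinearMap.proj (R := ℝ) (φ := fun _ : Fin 4 => ℝ) i).hasFDerivAt.const_mul r⁻¹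

lemma contDiffOn_cap {f g : R4 → ℝ} (s : ℝ) (hf : ContDiff ℝ ∞ f) (hg : ContDiff ℝ ∞ g)
    {U : Set R4} (h : ∀ x ∈ U, f x ^ 2 + g x ^ 2 < 4) :
    ContDiffOn ℝ ∞ (fun x => cap s (f x) (g x)) U := by
  have hq : ContDiffOn ℝ ∞ (fun x => √(1 - (f x ^ 2 + g x ^ 2) / 4)) U := by
    apply ContDiffOn.sqrt
    · exact (by fun_prop : ContDiff ℝ ∞ fun x => 1 - (f x ^ 2 + g x ^ 2) / 4).contDiffOn
    · intro x hx
      have := h x hx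
      linarith
  rw [contDiffOn_pi]
  intro i
  fin_cases i
  · exact hq.mul hf.contDiffOn
  · exact contDiffOn_const.mul (hq.mul hg.contDiffOn)
  · exact (by fun_prop : ContDiff ℝ ∞ fun x => s * (1 - (f x ^ 2 + g x ^ 2) / 2)).contDiffOn

lemma isCanonicalChart_baseChart {r₁ r₂ : ℝ} (h₁ : 0 < r₁) (h₂ : 0 < r₂) :
    IsCanonicalChart (r₁ ^ 2) (r₂ ^ 2) m₀ (baseDomain r₁ r₂) (baseChart r₁ r₂) where
  isOpen := by
    exact (isOpen_lt (f := fun x : R4 => (x 0 / r₁) ^ 2 + (x 2 / r₁) ^ 2) (g := fun _ => 4)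
      (by fun_prop) (by fun_prop)).inter
      (isOpen_lt (f := fun x : R4 => (x 1 / r₂) ^ 2 + (x 3 / r₂) ^ 2) (g := fun _ => 4)
      (by fun_prop) (by fun_prop))
  zero_mem := by simp [baseDomain]
  smooth := by
    apply ContDiffOn.prodMk
    · exact contDiffOn_cap 1 (by fun_prop) (by fun_prop) fun x hx => hx.1
    · exact contDiffOn_cap (-1) (by fun_prop) (by fun_prop) fun x hx => hx.2
  injOn := by
    intro x hx y _ e
    obtain ⟨e0, e2⟩ := cap_injective (by norm_num) hx.1 (congrArg Prod.fst e)
    obtain ⟨e1, e3⟩ := cap_injective (by norm_num) hx.2 (congrArg Prod.snd e)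
    ext i
    fin_cases i
    · exact (div_left_inj' h₁.ne').1 e0
    · exact (div_left_inj' h₂.ne').1 e1
    · exact (div_left_inj' h₁.ne').1 e2
    · exact (div_left_inj' h₂.ne').1 e3
  mapsTo := fun x hx =>
    ⟨dotProduct_cap (by norm_num) hx.1, dotProduct_cap (by norm_num) hx.2⟩
  map_zero := by
    ext i <;> fin_cases i <;> simp [baseChart, cap, m₀]
  pullback := by
    intro x hx v w
    obtain ⟨c₁, hc₁, e₁⟩ := hasFDerivAt_cap 1 (hasFDerivAt_coord_div 0 r₁ x)
      (hasFDerivAt_coord_div 2 r₁ x) hx.1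
    obtain ⟨c₂, hc₂, e₂⟩ := hasFDerivAt_cap (-1) (hasFDerivAt_coord_div 1 r₂ x)
      (hasFDerivAt_coord_div 3 r₂ x) hx.2
    have hd : HasFDerivAt (baseChart r₁ r₂) (c₁.prod c₂) x := hc₁.prodMk hc₂
    rw [hd.fderiv]
    simp only [omega, ContinuousLinearMap.prod_apply, e₁, e₂, baseChart]
    rw [area_cap (by norm_num) hx.1, area_cap (by norm_num) hx.2]
    simp only [omegaStd, smul_apply, ContinuousLinearMap.proj_apply,
      smul_eq_mul]
    field_simp

/-! ### Symplectic changes of coordinates -/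

/-- Smooth injective symplectic maps of `ℝ⁴` that fix the origin. -/
structure IsSymplecticMap (τ : R4 → R4) : Prop where
  smooth : ContDiff ℝ ∞ τ
  injective : Function.Injective τ
  map_zero : τ 0 = 0
  symplectic : ∀ x v w, omegaStd (fderiv ℝ τ x v) (fderiv ℝ τ x w) = omegaStd v w

lemma IsSymplecticMap.comp {τ τ' : R4 → R4} (h : IsSymplecticMap τ) (h' : IsSymplecticMap τ') :
    IsSymplecticMap (τ ∘ τ') where
  smooth := h.smooth.comp h'.smooth
  injective := h.injective.comp h'.injective
  map_zero := by simp [h.map_zero, h'.map_zero]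
  symplectic x v w := by
    rw [fderiv_comp x (h.smooth.differentiable (by simp) _)
      (h'.smooth.differentiable (by simp) _)]
    simp [h.symplectic, h'.symplectic]

lemma IsCanonicalChart.comp {R₁ R₂ : ℝ} {z₀ : R3 × R3} {U : Set R4} {φ : R4 → R3 × R3}
    {τ : R4 → R4} (h : IsCanonicalChart R₁ R₂ z₀ U φ) (hτ : IsSymplecticMap τ) :
    IsCanonicalChart R₁ R₂ z₀ (τ ⁻¹' U) (φ ∘ τ) where
  isOpen := h.isOpen.preimage hτ.smooth.continuous
  zero_mem := by simpa [hτ.map_zero] using h.zero_mem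
  smooth := h.smooth.comp hτ.smooth.contDiffOn fun _ hx => hx
  injOn := fun x hx y hy e => hτ.injective (h.injOn hx hy e)
  mapsTo := fun x hx => h.mapsTo hx
  map_zero := by simp [hτ.map_zero, h.map_zero]
  pullback := by
    intro x hx v w
    have hd : DifferentiableAt ℝ φ (τ x) :=
      (h.smooth.contDiffAt (h.isOpen.mem_nhds hx)).differentiableAt (by simp)
    rw [fderiv_comp x hd (hτ.smooth.differentiable (by simp) _)]
    simp only [Function.comp, ContinuousLinearMap.comp_apply]
    rw [h.pullback _ hx, hτ.symplectic]

lemma omegaStd_ne_zero {v : R4} (hv : v ≠ 0) : ∃ w, omegaStd v w ≠ 0 := by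
  by_contra! hw
  apply hv
  have a := hw ![1, 0, 0, 0]
  have b := hw ![0, 1, 0, 0]
  have c := hw ![0, 0, 1, 0]
  have d := hw ![0, 0, 0, 1]
  simp [omegaStd] at a b c d
  ext i
  fin_cases i <;> simp [a, b, c, d]

lemma isSymplecticMap_linear (L : R4 →L[ℝ] R4)
    (hL : ∀ v w, omegaStd (L v) (L w) = omegaStd v w) : IsSymplecticMap L where
  smooth := L.contDiff
  injective := by
    rw [injective_iff_map_eq_zero]
    intro v hv
    by_contra h0
    obtain ⟨w, hw⟩ := omegaStd_ne_zero h0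
    rw [← hL, hv] at hw
    simp [omegaStd] at hw
  map_zero := L.map_zero
  symplectic x v w := by simp [hL]

/-- The linear form `omegaStd l`. -/
def omegaForm (l : R4) : R4 →L[ℝ] ℝ :=
  l 0 • ContinuousLinearMap.proj 2 - l 2 • ContinuousLinearMap.proj 0
    + (l 1 • ContinuousLinearMap.proj 3 - l 3 • ContinuousLinearMap.proj 1)

@[simp] lemma omegaForm_apply (l x : R4) : omegaForm l x = omegaStd l x := by
  simp [omegaForm, omegaStd]

/-- Hamiltonian vector field of a multiple of the fourth power of a linear form. -/
def cubeField (c : ℝ) (l x : R4) : R4 := (c * omegaForm l x ^ 3) • l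

/-- The time-one flow of `cubeField c l`. -/
def shear (c : ℝ) (l x : R4) : R4 := x + cubeField c l x

lemma omegaForm_shear (c : ℝ) (l x : R4) : omegaForm l (shear c l x) = omegaForm l x := by
  have : omegaForm l l = 0 := by simp [omegaStd]; ring
  rw [shear, cubeField, map_add, map_smul, this]
  simp

lemma hasFDerivAt_shear (c : ℝ) (l x : R4) :
    HasFDerivAt (shear c l)
      (ContinuousLinearMap.id ℝ R4
        + ((c * (3 * omegaForm l x ^ 2)) • omegaForm l).smulRight l) x := by
  have h := (((omegaForm l).hasFDerivAt (x := x)).pow 3).const_mul c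
  have e : (c * (3 * omegaForm l x ^ 2)) • omegaForm l
      = c • (3 • omegaForm l x ^ (3 - 1)) • omegaForm l := by
    ext v
    simp
    ring
  rw [e]
  exact (hasFDerivAt_id x).add (h.smul_const l)

/-- Since `omegaStd l l = 0`, the form `omegaForm l` is constant along the shear, so the
displacement can be recovered from the image; the derivative at each point is a symplectic
transvection along `l`. -/
lemma isSymplecticMap_shear (c : ℝ) (l : R4) : IsSymplecticMap (shear c l) where
  smooth := by
    unfold shear cubeField
    fun_prop
  injective := by
    intro x y e
    have h := omegaForm_shear c l x
    rw [e, omegaForm_shear] at h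
    simpa [shear, cubeField, h] using e
  map_zero := by simp [shear, cubeField, omegaStd]
  symplectic x v w := by
    rw [(hasFDerivAt_shear c l x).fderiv]
    simp [omegaStd]
    ring

/-- Cubic vector fields that are finite sums of Hamiltonian vector fields of fourth powers of
linear forms. -/
def cubicFields : AddSubmonoid (R4 → R4) :=
  AddSubmonoid.closure {Y | ∃ c l, Y = cubeField c l}

lemma cubeField_mem (c : ℝ) (l : R4) : cubeField c l ∈ cubicFields :=
  AddSubmonoid.subset_closure ⟨c, l, rfl⟩

/-- `c` times the Hamiltonian vector field of the product of four linear forms. -/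
def prodField (k : ℝ) (a b c d x : R4) : R4 :=
  k • ((omegaForm b x * omegaForm c x * omegaForm d x) • a
    + (omegaForm a x * omegaForm c x * omegaForm d x) • b
    + (omegaForm a x * omegaForm b x * omegaForm d x) • c
    + (omegaForm a x * omegaForm b x * omegaForm c x) • d)

/-- Polarization: `192 abcd` is the signed sum of the eight fourth powers `(a ± b ± c ± d)⁴`. As
`cubeField c l` belongs to the Hamiltonian `(c/4) (omegaForm l)⁴`, the coefficients become `±k/48`.
-/
lemma prodField_mem (k : ℝ) (a b c d : R4) : prodField k a b c d ∈ cubicFields := by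
  have e : prodField k a b c d =
      cubeField (k / 48) (a + b + c + d) + cubeField (-k / 48) (a + b + c - d)
      + (cubeField (-k / 48) (a + b - c + d) + cubeField (k / 48) (a + b - c - d))
      + (cubeField (-k / 48) (a - b + c + d) + cubeField (k / 48) (a - b + c - d)
      + (cubeField (k / 48) (a - b - c + d) + cubeField (-k / 48) (a - b - c - d))) := by
    ext x i
    have hadd : ∀ u v : R4, omegaForm (u + v) x = omegaForm u x + omegaForm v x := by
      intro u v; simp [omegaStd]; ring
    have hsub : ∀ u v : R4, omegaForm (u - v) x = omegaForm u x - omegaForm v x := by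
      intro u v; simp [omegaStd]; ring
    simp only [prodField, cubeField, Pi.add_apply, Pi.sub_apply, Pi.smul_apply, smul_eq_mul,
      hadd, hsub]
    ring
  rw [e]
  have m := fun c l => cubeField_mem c l
  exact add_mem (add_mem (add_mem (m _ _) (m _ _)) (add_mem (m _ _) (m _ _)))
    (add_mem (add_mem (m _ _) (m _ _)) (add_mem (m _ _) (m _ _)))

lemma isBigO_clm {F : Type*} [NormedAddCommGroup F] [NormedSpace ℝ F] (L : R4 →L[ℝ] F)
    (l : Filter R4) : (fun x => L x) =O[l] fun x => ‖x‖ :=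
  (L.isBigO_id l).norm_right

lemma isLittleO_norm_pow {m n : ℕ} (h : m < n) :
    (fun x : R4 => ‖x‖ ^ n) =o[𝓝 0] fun x => ‖x‖ ^ m :=
  (isLittleO_pow_pow h).comp_tendsto tendsto_norm_zero

lemma isBigO_cubeField (c : ℝ) (l : R4) : cubeField c l =O[𝓝 0] fun x => ‖x‖ ^ 3 := by
  have h := ((isBigO_clm (omegaForm l) (𝓝 0)).pow 3).const_mul_left c
  have h2 := h.smul (isBigO_refl (fun _ : R4 => l) (𝓝 0))
  refine h2.trans ?_
  refine IsBigO.of_bound ‖l‖ (Eventually.of_forall fun x => ?_)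
  rw [norm_smul, mul_comm]

/-- Each cubic field is the leading part of a symplectic map tangent to the identity. -/
lemma exists_isSymplecticMap {Y : R4 → R4} (hY : Y ∈ cubicFields) :
    (Y =O[𝓝 0] fun x => ‖x‖ ^ 3) ∧
    ∃ τ, IsSymplecticMap τ ∧ (fun x => τ x - x - Y x) =o[𝓝 0] fun x => ‖x‖ ^ 3 := by
  induction hY using AddSubmonoid.closure_induction_left with
  | zero =>
    refine ⟨isBigO_zero _ _, id, ?_, ?_⟩
    · exact isSymplecticMap_linear (ContinuousLinearMap.id ℝ R4) (by simp)
    · simp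
  | add_left Z hZ Y hY ih =>
    obtain ⟨c, l, rfl⟩ := hZ
    obtain ⟨hO, τ, hτ, ho⟩ := ih
    refine ⟨(isBigO_cubeField c l).add hO, shear c l ∘ τ, (isSymplecticMap_shear c l).comp hτ, ?_⟩
    have h3 : (fun x => τ x - x) =O[𝓝 0] fun x => ‖x‖ ^ 3 := by
      simpa using ho.isBigO.add hO
    have h31 : (fun x : R4 => ‖x‖ ^ 3) =O[𝓝 0] fun x => ‖x‖ := by
      simpa using (isLittleO_norm_pow (show 1 < 3 by norm_num)).isBigO
    have h1 : τ =O[𝓝 0] fun x => ‖x‖ := by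
      simpa using (h3.trans h31).add (isBigO_refl (fun x : R4 => x) (𝓝 0)).norm_right
    have hu : (fun x => omegaForm l (τ x)) =O[𝓝 0] fun x => ‖x‖ :=
      ((omegaForm l).isBigO_comp τ _).trans h1
    have hv := isBigO_clm (omegaForm l) (𝓝 0)
    have hd : (fun x => omegaForm l (τ x) - omegaForm l x) =O[𝓝 0] fun x => ‖x‖ ^ 3 := by
      simpa only [map_sub] using ((omegaForm l).isBigO_comp (fun x => τ x - x) _).trans h3
    have hq : (fun x => omegaForm l (τ x) ^ 2 + omegaForm l (τ x) * omegaForm l x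
        + omegaForm l x ^ 2) =O[𝓝 0] fun x => ‖x‖ ^ 2 :=
      ((hu.pow 2).add (by simpa only [sq] using hu.mul hv)).add (hv.pow 2)
    -- Factor `u³ - v³ = (u - v)(u² + uv + v²)`: the shear displacement at `τ x` differs from that
    -- at `x` only at order five, so leading cubic fields add under composition.
    have hc : (fun x => cubeField c l (τ x) - cubeField c l x) =o[𝓝 0] fun x => ‖x‖ ^ 3 := by
      have hm := ((hd.mul hq).const_mul_left c)
      simp only [← pow_add] at hm
      have hs := (hm.trans_isLittleO (isLittleO_norm_pow (show 3 < 3 + 2 by norm_num))).smul_isBigO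
        (isBigO_refl (fun _ : R4 => l) (𝓝 0))
      have he : (fun x : R4 => ‖x‖ ^ 3 • l) =O[𝓝 0] fun x => ‖x‖ ^ 3 := by
        refine IsBigO.of_bound ‖l‖ (Eventually.of_forall fun x => ?_)
        rw [norm_smul, mul_comm]
      refine (hs.trans_isBigO he).congr_left fun x => ?_
      simp only [cubeField, ← sub_smul]
      congr 1
      ring
    refine (ho.add hc).congr_left fun x => ?_
    simp only [Function.comp, shear, Pi.add_apply]
    abel

/-! ### Jets and the normal form -/

lemma isBigO_coord (i : Fin 4) : (fun x : R4 => x i) =O[𝓝 0] fun x => ‖x‖ :=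
  isBigO_clm (ContinuousLinearMap.proj (R := ℝ) (φ := fun _ : Fin 4 => ℝ) i) _

lemma isBigO_coord_mul (i j : Fin 4) : (fun x : R4 => x i * x j) =O[𝓝 0] fun x => ‖x‖ ^ 2 := by
  simpa only [sq] using (isBigO_coord i).mul (isBigO_coord j)

lemma isBigO_genS : genS =O[𝓝 0] fun x => ‖x‖ ^ 2 :=
  (isBigO_coord_mul 0 3).sub (isBigO_coord_mul 1 2)

lemma isBigO_genM : genM =O[𝓝 0] fun x => ‖x‖ ^ 2 :=
  (((isBigO_coord_mul 0 0).add (isBigO_coord_mul 1 1)).const_mul_left (1 / 2)).congr_left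
    fun x => by simp only [genM]; ring

lemma isBigO_genN : genN =O[𝓝 0] fun x => ‖x‖ ^ 2 :=
  (((isBigO_coord_mul 2 2).add (isBigO_coord_mul 3 3)).const_mul_left (1 / 2)).congr_left
    fun x => by simp only [genN]; ring

lemma IsSymplecticMap.isBigO {τ : R4 → R4} (h : IsSymplecticMap τ) :
    τ =O[𝓝 0] fun x => ‖x‖ := by
  have := (h.smooth.differentiable (by simp) 0).isBigO_sub
  simpa [h.map_zero] using this.norm_right

lemma IsSymplecticMap.isLittleO_comp {τ : R4 → R4} (h : IsSymplecticMap τ) {f : R4 → ℝ} {n : ℕ}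
    (hf : f =o[𝓝 0] fun x => ‖x‖ ^ n) : (f ∘ τ) =o[𝓝 0] fun x => ‖x‖ ^ n := by
  have ht : Tendsto τ (𝓝 0) (𝓝 0) := by
    simpa [h.map_zero] using h.smooth.continuous.tendsto 0
  exact (hf.comp_tendsto ht).trans_isBigO (h.isBigO.norm_left.pow n)

lemma coord_mul_comp {τ Y : R4 → R4} (hY : Y =O[𝓝 0] fun x => ‖x‖ ^ 3)
    (h : (fun x => τ x - x - Y x) =o[𝓝 0] fun x => ‖x‖ ^ 3) (i j : Fin 4) :
    (fun x => τ x i * τ x j - x i * x j - (x i * Y x j + Y x i * x j))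
      =o[𝓝 0] fun x => ‖x‖ ^ 4 := by
  have he : ∀ k, (fun x => τ x k - x k - Y x k) =o[𝓝 0] fun x => ‖x‖ ^ 3 :=
    fun k => isLittleO_pi.1 h k
  have hd : ∀ k, (fun x => τ x k - x k) =O[𝓝 0] fun x => ‖x‖ ^ 3 := fun k => by
    simpa using (he k).isBigO.add (isBigO_pi.1 hY k)
  have h1 := (isBigO_coord i).mul_isLittleO (he j)
  have h2 := (he i).mul_isBigO (isBigO_coord j)
  have h3 := (hd i).mul (hd j)
  simp only [← pow_succ, ← pow_succ', ← pow_add] at h1 h2 h3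
  refine ((h1.add h2).add (h3.trans_isLittleO
    (isLittleO_norm_pow (show 4 < 3 + 3 by norm_num)))).congr_left fun x => ?_
  ring

/-- Quartic terms do not feel the normalizing map at order four; only the quadratic part contributes
a correction. -/
lemma mul_comp_sub {τ : R4 → R4} (hτ : IsSymplecticMap τ) {g h : R4 → ℝ}
    (hg : g =O[𝓝 0] fun x => ‖x‖ ^ 2) (hh : h =O[𝓝 0] fun x => ‖x‖ ^ 2)
    (hgd : (fun x => g (τ x) - g x) =o[𝓝 0] fun x => ‖x‖ ^ 2)
    (hhd : (fun x => h (τ x) - h x) =o[𝓝 0] fun x => ‖x‖ ^ 2) :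
    (fun x => g (τ x) * h (τ x) - g x * h x) =o[𝓝 0] fun x => ‖x‖ ^ 4 := by
  have ht : Tendsto τ (𝓝 0) (𝓝 0) := by
    simpa [hτ.map_zero] using hτ.smooth.continuous.tendsto 0
  have hgt := (hg.comp_tendsto ht).trans (hτ.isBigO.norm_left.pow 2)
  have h1 := hgt.mul_isLittleO hhd
  have h2 := hgd.mul_isBigO hh
  simp only [← pow_add] at h1 h2
  refine (h1.add h2).congr_left fun x => ?_
  simp only [Function.comp]
  ring

lemma isLittleO_sub_of_isBigO {g g' : R4 → ℝ} {f : R4 → ℝ}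
    (h : (fun x => f x - g x - g' x) =o[𝓝 0] fun x => ‖x‖ ^ 4)
    (hg' : g' =O[𝓝 0] fun x => ‖x‖ ^ 4) :
    (fun x => f x - g x) =o[𝓝 0] fun x => ‖x‖ ^ 2 := by
  have := h.isBigO.add hg'
  simp only [sub_add_cancel] at this
  exact this.trans_isLittleO (isLittleO_norm_pow (by norm_num))

/-- Hamiltonian vector field of `(q₁ p₁ + q₂ p₂) (k M + m N + n S)`. -/
def normalizingField (k m n : ℝ) : R4 → R4 :=
  -- Each vector represents the coordinate function of its name through `omegaForm`, hence the signs
  -- for `q₁`, `q₂`.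
  let q₁ : R4 := ![0, 0, -1, 0]
  let q₂ : R4 := ![0, 0, 0, -1]
  let p₁ : R4 := ![1, 0, 0, 0]
  let p₂ : R4 := ![0, 1, 0, 0]
  (prodField (k / 2) q₁ q₁ q₁ p₁ + prodField (k / 2) q₁ q₁ q₂ p₂
    + (prodField (k / 2) q₂ q₂ q₁ p₁ + prodField (k / 2) q₂ q₂ q₂ p₂))
  + ((prodField (m / 2) p₁ p₁ q₁ p₁ + prodField (m / 2) p₁ p₁ q₂ p₂
    + (prodField (m / 2) p₂ p₂ q₁ p₁ + prodField (m / 2) p₂ p₂ q₂ p₂))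
  + (prodField n q₁ p₂ q₁ p₁ + prodField n q₁ p₂ q₂ p₂
    + (prodField (-n) q₂ p₁ q₁ p₁ + prodField (-n) q₂ p₁ q₂ p₂)))

lemma normalizingField_mem (k m n : ℝ) : normalizingField k m n ∈ cubicFields := by
  have h := prodField_mem
  have h4 := fun a b c d : cubicFields => add_mem (add_mem a.2 b.2) (add_mem c.2 d.2)
  exact add_mem (h4 ⟨_, h _ _ _ _ _⟩ ⟨_, h _ _ _ _ _⟩ ⟨_, h _ _ _ _ _⟩ ⟨_, h _ _ _ _ _⟩)
    (add_mem (h4 ⟨_, h _ _ _ _ _⟩ ⟨_, h _ _ _ _ _⟩ ⟨_, h _ _ _ _ _⟩ ⟨_, h _ _ _ _ _⟩)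
    (h4 ⟨_, h _ _ _ _ _⟩ ⟨_, h _ _ _ _ _⟩ ⟨_, h _ _ _ _ _⟩ ⟨_, h _ _ _ _ _⟩))

lemma normalizingField_apply (k m n : ℝ) (x : R4) :
    normalizingField k m n x =
      let T := x 0 * x 2 + x 1 * x 3
      let V := k * genM x + m * genN x + n * genS x
      ![x 0 * V + T * (m * x 2 - n * x 1), x 1 * V + T * (m * x 3 + n * x 0),
        -(x 2 * V + T * (k * x 0 + n * x 3)), -(x 3 * V + T * (k * x 1 - n * x 2))] := by
  ext i
  fin_cases i <;>
    simp [normalizingField, prodField, omegaStd, genM, genN, genS] <;> ring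

/-- Birkhoff normalization of fourth order terms in `M`, `N`, `S` with respect to `ρ S + σ N`. -/
lemma exists_normalization {σ : ℝ} (hσ : σ ^ 2 = 1) (ρ A B C D E F : ℝ) :
    ∃ τ, IsSymplecticMap τ ∧ ∀ f : R4 → ℝ,
      (fun x => f x - (ρ * genS x + σ * genN x) - (A * (genM x * genM x) + B * (genM x * genN x)
        + C * (genN x * genN x) + D * (genM x * genS x) + E * (genN x * genS x)
        + F * (genS x * genS x))) =o[𝓝 0] (fun x => ‖x‖ ^ 4) →
      (fun x => f (τ x) - (ρ * genS x + σ * genN x + (A * genM x ^ 2 + D * (genM x * genS x)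
        + (F + B / 6) * genS x ^ 2))) =o[𝓝 0] fun x => ‖x‖ ^ 4 := by
  -- Let `T = q₁p₁ + q₂p₂`. Along the flow of `N`, `T' = 2N`, `M' = T`, and `T² = 4MN - S²`. Hence
  -- `TM`, `TN`, `TS` have derivatives `6MN - S²`, `2N²`, `2NS`. This dictates the divisors 6, 2, 2
  -- and the leftover `(B/6) S²`; the factor `σ` stands for `1/σ`.
  obtain ⟨hY, τ, hτ, ho⟩ := exists_isSymplecticMap
    (normalizingField_mem (σ * B / 6) (σ * C / 2) (σ * E / 2))
  set Y := normalizingField (σ * B / 6) (σ * C / 2) (σ * E / 2) with hYdef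
  refine ⟨τ, hτ, fun f hf => ?_⟩
  have hc := coord_mul_comp hY ho
  have hS : (fun x => genS (τ x) - genS x - (x 0 * Y x 3 + Y x 0 * x 3
      - (x 1 * Y x 2 + Y x 1 * x 2))) =o[𝓝 0] fun x => ‖x‖ ^ 4 :=
    ((hc 0 3).sub (hc 1 2)).congr_left fun x => by simp only [genS]; ring
  have hM : (fun x => genM (τ x) - genM x - (x 0 * Y x 0 + x 1 * Y x 1))
      =o[𝓝 0] fun x => ‖x‖ ^ 4 :=
    (((hc 0 0).add (hc 1 1)).const_mul_left (1 / 2)).congr_left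
      fun x => by simp only [genM]; ring
  have hN : (fun x => genN (τ x) - genN x - (x 2 * Y x 2 + x 3 * Y x 3))
      =o[𝓝 0] fun x => ‖x‖ ^ 4 :=
    (((hc 2 2).add (hc 3 3)).const_mul_left (1 / 2)).congr_left
      fun x => by simp only [genN]; ring
  have hxY : ∀ i j, (fun x => x i * Y x j) =O[𝓝 0] fun x => ‖x‖ ^ 4 := fun i j => by
    simpa only [← pow_succ'] using (isBigO_coord i).mul (isBigO_pi.1 hY j)
  have hYx : ∀ i j, (fun x => Y x i * x j) =O[𝓝 0] fun x => ‖x‖ ^ 4 := fun i j => by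
    simpa only [← pow_succ] using (isBigO_pi.1 hY i).mul (isBigO_coord j)
  have hS2 := isLittleO_sub_of_isBigO hS
    (((hxY 0 3).add (hYx 0 3)).sub ((hxY 1 2).add (hYx 1 2)))
  have hM2 := isLittleO_sub_of_isBigO hM ((hxY 0 0).add (hxY 1 1))
  have hN2 := isLittleO_sub_of_isBigO hN ((hxY 2 2).add (hxY 3 3))
  have q1 := (mul_comp_sub hτ isBigO_genM isBigO_genM hM2 hM2).const_mul_left A
  have q2 := (mul_comp_sub hτ isBigO_genM isBigO_genN hM2 hN2).const_mul_left B
  have q3 := (mul_comp_sub hτ isBigO_genN isBigO_genN hN2 hN2).const_mul_left C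
  have q4 := (mul_comp_sub hτ isBigO_genM isBigO_genS hM2 hS2).const_mul_left D
  have q5 := (mul_comp_sub hτ isBigO_genN isBigO_genS hN2 hS2).const_mul_left E
  have q6 := (mul_comp_sub hτ isBigO_genS isBigO_genS hS2 hS2).const_mul_left F
  refine ((((((((hτ.isLittleO_comp hf).add q1).add q2).add q3).add q4).add q5).add q6).add
    ((hS.const_mul_left ρ).add (hN.const_mul_left σ))).congr_left fun x => ?_
  -- The homological equation. The `ρ` term drops out because the generating function is invariant
  -- under the rotations generated by `S`.
  have e : ρ * (x 0 * Y x 3 + Y x 0 * x 3 - (x 1 * Y x 2 + Y x 1 * x 2))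
      + σ * (x 2 * Y x 2 + x 3 * Y x 3) + (B * (genM x * genN x)
        + C * (genN x * genN x) + E * (genN x * genS x)) = B / 6 * genS x ^ 2 := by
    rw [hYdef, normalizingField_apply]
    have h := congrArg (· * (B / 6 * (6 * genM x * genN x - genS x ^ 2) + C * genN x ^ 2
      + E * genN x * genS x)) hσ
    simp only [genS, genM, genN, Matrix.cons_val] at h ⊢
    linear_combination -h
  simp only [Function.comp]
  linear_combination -e

/-! ### The Taylor expansion of the Gaudin Hamiltonian -/

/-- Quadratic part of the Hamiltonian in the base chart. -/
def quadPart (α β γ : ℝ) (x : R4) : ℝ :=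
  α * ((x 0 ^ 2 + x 2 ^ 2) / 2) + β * ((x 1 ^ 2 + x 3 ^ 2) / 2) + γ * (x 0 * x 1 - x 2 * x 3)

/-- Quartic part of the Hamiltonian in the base chart. -/
def quartPart (κ γ c₁ c₂ : ℝ) (x : R4) : ℝ :=
  -κ * ((x 0 ^ 2 + x 2 ^ 2) / 2 * ((x 1 ^ 2 + x 3 ^ 2) / 2))
    - γ / 4 * ((x 0 * x 1 - x 2 * x 3)
      * (c₁ * ((x 0 ^ 2 + x 2 ^ 2) / 2) + c₂ * ((x 1 ^ 2 + x 3 ^ 2) / 2)))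

lemma isBigO_quartPart (κ γ c₁ c₂ : ℝ) :
    quartPart κ γ c₁ c₂ =O[𝓝 0] fun x => ‖x‖ ^ 4 := by
  have j₁ := ((isBigO_coord_mul 0 0).add (isBigO_coord_mul 2 2)).const_mul_left (1 / 2)
  have j₂ := ((isBigO_coord_mul 1 1).add (isBigO_coord_mul 3 3)).const_mul_left (1 / 2)
  have k := (isBigO_coord_mul 0 1).sub (isBigO_coord_mul 2 3)
  have h1 := (j₁.mul j₂).const_mul_left (-κ)
  have h2 := (k.mul ((j₁.const_mul_left c₁).add (j₂.const_mul_left c₂))).const_mul_left (γ / 4)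
  simp only [← pow_add] at h1 h2
  refine (h1.sub h2).congr_left fun x => ?_
  simp only [quartPart]
  ring

lemma isLittleO_sqrt_sub :
    (fun s : ℝ => √(1 - s) - 1 + s / 2) =o[𝓝 0] fun s => s := by
  have h : HasDerivAt (fun s : ℝ => √(1 - s)) (-(1 / 2)) 0 := by
    have := ((hasDerivAt_id (0 : ℝ)).const_sub 1).sqrt (by simp)
    simpa [neg_div] using this
  have := h.isLittleO
  simp only [sub_zero, smul_eq_mul, Real.sqrt_one] at this
  refine this.congr_left fun s => ?_
  ring

lemma isLittleO_cap (i j : Fin 4) (r : ℝ) :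
    (fun x : R4 => √(1 - ((x i / r) ^ 2 + (x j / r) ^ 2) / 4) - 1
      + ((x i / r) ^ 2 + (x j / r) ^ 2) / 8) =o[𝓝 0] fun x => ‖x‖ ^ 2 := by
  have hO : (fun x : R4 => ((x i / r) ^ 2 + (x j / r) ^ 2) / 4) =O[𝓝 0] fun x => ‖x‖ ^ 2 :=
    (((isBigO_coord_mul i i).add (isBigO_coord_mul j j)).const_mul_left ((r⁻¹) ^ 2 / 4)).congr_left
      fun x => by simp only [div_eq_mul_inv]; ring
  have ht : Tendsto (fun x : R4 => ((x i / r) ^ 2 + (x j / r) ^ 2) / 4) (𝓝 0) (𝓝 0) := by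
    have hc : Continuous (fun x : R4 => ((x i / r) ^ 2 + (x j / r) ^ 2) / 4) := by fun_prop
    simpa using hc.tendsto 0
  refine ((isLittleO_sqrt_sub.comp_tendsto ht).trans_isBigO hO).congr_left fun x => ?_
  simp only [Function.comp]
  ring

lemma hamiltonian_expansion {r₁ r₂ : ℝ} (h₁ : r₁ ≠ 0) (h₂ : r₂ ≠ 0) (t₁ t₂ t₃ t : ℝ) :
    (fun x => hamiltonian 1 0 t₁ t₂ t₃ t (baseChart r₁ r₂ x) - hamiltonian 1 0 t₁ t₂ t₃ t m₀
      - quadPart ((t - t₁) / r₁ ^ 2) ((t + t₂) / r₂ ^ 2) (t₃ / (r₁ * r₂)) x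
      - quartPart (t / (r₁ ^ 2 * r₂ ^ 2)) (t₃ / (r₁ * r₂)) (1 / r₁ ^ 2) (1 / r₂ ^ 2) x)
      =o[𝓝 0] fun x => ‖x‖ ^ 4 := by
  have e₁ := isLittleO_cap 0 2 r₁
  have e₂ := isLittleO_cap 1 3 r₂
  have hj : ∀ (i j : Fin 4) (r : ℝ),
      (fun x : R4 => ((x i / r) ^ 2 + (x j / r) ^ 2) / 8) =O[𝓝 0] fun x => ‖x‖ ^ 2 :=
    fun i j r =>
    (((isBigO_coord_mul i i).add (isBigO_coord_mul j j)).const_mul_left ((r⁻¹) ^ 2 / 8)).congr_left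
      fun x => by simp only [div_eq_mul_inv]; ring
  have g₁ := e₁.isBigO.sub (hj 0 2 r₁)
  have g₂ := e₂.isBigO.sub (hj 1 3 r₂)
  have g := g₁.mul g₂
  simp only [← pow_add] at g
  -- The `z` coordinates are polynomial in the chart, so the only error comes from the product of
  -- the two square roots, via `ab - 1 = (a - 1) + (b - 1) + (a - 1)(b - 1)`.
  have w := (e₁.add e₂).add (g.trans_isLittleO (isLittleO_norm_pow (show 2 < 2 + 2 by norm_num)))
  have k := ((isBigO_coord_mul 0 1).sub (isBigO_coord_mul 2 3)).const_mul_left (t₃ / (r₁ * r₂))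
  have kw := k.mul_isLittleO w
  simp only [← pow_add] at kw
  refine kw.congr_left fun x => ?_
  simp only [hamiltonian, baseChart, cap, m₀, quadPart, quartPart, Matrix.cons_val]
  set a := √(1 - ((x 0 / r₁) ^ 2 + (x 2 / r₁) ^ 2) / 4)
  set b := √(1 - ((x 1 / r₂) ^ 2 + (x 3 / r₂) ^ 2) / 4)
  field_simp
  ring

/-- Linear change of coordinates adapted to the Hopf normal form, symplectic if `μ * l = 1`. -/
def hopfMap (μ l : ℝ) : R4 →L[ℝ] R4 :=
  μ • ContinuousLinearMap.pi ![(1 / 2 : ℝ) • ContinuousLinearMap.proj 2,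
      (1 / 2 : ℝ) • ContinuousLinearMap.proj 2, (1 / 2 : ℝ) • ContinuousLinearMap.proj 3,
      -((1 / 2 : ℝ) • ContinuousLinearMap.proj 3)]
    + l • ContinuousLinearMap.pi ![ContinuousLinearMap.proj 1, -ContinuousLinearMap.proj 1,
      -ContinuousLinearMap.proj 0, -ContinuousLinearMap.proj 0]

lemma hopfMap_apply (μ l : ℝ) (x : R4) : hopfMap μ l x =
    ![μ * (x 2 / 2) + l * x 1, μ * (x 2 / 2) - l * x 1, μ * (x 3 / 2) - l * x 0,
      -(μ * (x 3 / 2)) - l * x 0] := by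
  ext i
  fin_cases i <;> simp [hopfMap, div_eq_inv_mul, sub_eq_add_neg]

/-- The symplectic map `(q, p) ↦ (-p, q)`. -/
def swap : R4 →L[ℝ] R4 :=
  ContinuousLinearMap.pi ![-ContinuousLinearMap.proj 2, -ContinuousLinearMap.proj 3,
    ContinuousLinearMap.proj 0, ContinuousLinearMap.proj 1]

lemma swap_apply (x : R4) : swap x = ![-x 2, -x 3, x 0, x 1] := by
  ext i
  fin_cases i <;> simp [swap]

lemma omegaStd_hopfMap {μ l : ℝ} (h : μ * l = 1) (v w : R4) :
    omegaStd (hopfMap μ l v) (hopfMap μ l w) = omegaStd v w := by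
  simp only [omegaStd, hopfMap_apply, Matrix.cons_val]
  linear_combination (v 0 * w 2 - v 2 * w 0 + (v 1 * w 3 - v 3 * w 1)) * h

lemma omegaStd_swap (v w : R4) : omegaStd (swap v) (swap w) = omegaStd v w := by
  simp only [omegaStd, swap_apply, Matrix.cons_val]
  ring

lemma genS_swap (x : R4) : genS (swap x) = genS x := by
  simp only [genS, swap_apply, Matrix.cons_val]; ring

lemma genM_swap (x : R4) : genM (swap x) = genN x := by
  simp only [genM, genN, swap_apply, Matrix.cons_val]; ring

lemma genN_swap (x : R4) : genN (swap x) = genM x := by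
  simp only [genM, genN, swap_apply, Matrix.cons_val]

lemma action_hopfMap {μ l : ℝ} (h : μ * l = 1) (x : R4) :
    ((hopfMap μ l x) 0 ^ 2 + (hopfMap μ l x) 2 ^ 2) / 2
        = (μ ^ 2 / 2 * genN x + 2 * l ^ 2 * genM x - genS x) / 2 ∧
      ((hopfMap μ l x) 1 ^ 2 + (hopfMap μ l x) 3 ^ 2) / 2
        = (μ ^ 2 / 2 * genN x + 2 * l ^ 2 * genM x + genS x) / 2 ∧
      (hopfMap μ l x) 0 * (hopfMap μ l x) 1 - (hopfMap μ l x) 2 * (hopfMap μ l x) 3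
        = μ ^ 2 / 2 * genN x - 2 * l ^ 2 * genM x := by
  simp only [genS, genM, genN, hopfMap_apply, Matrix.cons_val]
  refine ⟨?_, ?_, ?_⟩
  · linear_combination ((x 2 * x 1 - x 3 * x 0) / 2) * h
  · linear_combination ((x 0 * x 3 - x 1 * x 2) / 2) * h
  · ring

lemma quadPart_hopfMap {μ l : ℝ} (h : μ * l = 1) (α β γ : ℝ) (x : R4) :
    quadPart α β γ (hopfMap μ l x) = (β - α) / 2 * genS x
      + ((α + β) / 2 + γ) / 2 * μ ^ 2 * genN x + 2 * ((α + β) / 2 - γ) * l ^ 2 * genM x := by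
  obtain ⟨e₁, e₂, e₃⟩ := action_hopfMap h x
  rw [quadPart, e₁, e₂, e₃]
  ring

/-- With `J₁ + J₂ = X + Y` and `K = X - Y`, where `X`, `Y` are the multiples of `N`, `M`: `J₁J₂ =
((X + Y)² - S²)/4`, while `K (J₁ + J₂) = X² - Y²` has no mixed term. So `MN` arises from `κ` alone.
-/
lemma quartPart_hopfMap {μ l : ℝ} (h : μ * l = 1) (κ γ c₁ c₂ : ℝ) (x : R4) :
    quartPart κ γ c₁ c₂ (hopfMap μ l x) =
      l ^ 4 * (γ * (c₁ + c₂) / 2 - κ) * (genM x * genM x)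
      + (-κ / 2) * (genM x * genN x)
      + (-(κ + γ * (c₁ + c₂) / 2) / 16 * μ ^ 4) * (genN x * genN x)
      + (γ * (c₂ - c₁) / 4 * l ^ 2) * (genM x * genS x)
      + (-γ * (c₂ - c₁) / 16 * μ ^ 2) * (genN x * genS x)
      + κ / 4 * (genS x * genS x) := by
  obtain ⟨e₁, e₂, e₃⟩ := action_hopfMap h x
  rw [quartPart, e₁, e₂, e₃]
  linear_combination (-κ / 2 * (genM x * genN x)) * (μ * l + 1) * h

/-! ### The bifurcation -/

lemma isLinearHHB_hamiltonian {r₁ r₂ t₁ t₂ t₃ t₀ σ : ℝ} (h₁ : 0 < r₁) (h₂ : 0 < r₂)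
    (hσ : σ ^ 2 = 1) (hγ : 0 < σ * (t₃ / (r₁ * r₂)))
    (ht₀ : ((t₀ - t₁) / r₁ ^ 2 + (t₀ + t₂) / r₂ ^ 2) / 2 = t₃ / (r₁ * r₂)) :
    IsLinearHHB (r₁ ^ 2) (r₂ ^ 2) (fun t => hamiltonian 1 0 t₁ t₂ t₃ t) m₀ t₀
      (((t₀ + t₂) / r₂ ^ 2 - (t₀ - t₁) / r₁ ^ 2) / 2) σ := by
  set γ := t₃ / (r₁ * r₂) with hγdef
  set k := (1 / r₁ ^ 2 + 1 / r₂ ^ 2) / 2 with hk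
  have hk0 : 0 < k := by positivity
  have hε : ∀ t, ((t - t₁) / r₁ ^ 2 + (t + t₂) / r₂ ^ 2) / 2 = γ + k * (t - t₀) := by
    intro t
    rw [← ht₀, hk]
    ring
  -- On this interval the perturbation `k (t - t₀)/2` is at most half of `γ` in size, so the
  -- radicand keeps its sign.
  have hpos : ∀ t ∈ Set.Ioo (t₀ - σ * γ / k) (t₀ + σ * γ / k),
      0 < σ * (γ + k * (t - t₀) / 2) := by
    rintro t ⟨ha, hb⟩
    have hkk : k * (σ * γ / k) = σ * γ := by field_simp
    have ha' := mul_lt_mul_of_pos_left ha hk0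
    have hb' := mul_lt_mul_of_pos_left hb hk0
    rw [mul_sub, hkk] at ha'
    rw [mul_add, hkk] at hb'
    rcases (show σ = 1 ∨ σ = -1 by simpa using hσ) with rfl | rfl <;> linarith
  have hl : ContDiffOn ℝ ∞ (fun t => √(σ * (γ + k * (t - t₀) / 2)))
      (Set.Ioo (t₀ - σ * γ / k) (t₀ + σ * γ / k)) := by
    apply ContDiffOn.sqrt
    · exact (by fun_prop : ContDiff ℝ ∞ fun t => σ * (γ + k * (t - t₀) / 2)).contDiffOn
    · exact fun t ht => (hpos t ht).ne'
  -- The choice of `l²` normalizes the coefficient of `N` to `σ` for every `t`; `swap` then makes it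
  -- the coefficient of `M`. The former coefficient of `M`, namely `2 k (t - t₀) l²`, becomes `-ν₂`.
  refine ⟨_, _, σ * γ / k, fun t => (hopfMap (√(σ * (γ + k * (t - t₀) / 2)))⁻¹
      (√(σ * (γ + k * (t - t₀) / 2)))).comp swap,
    fun t => ((t + t₂) / r₂ ^ 2 - (t - t₁) / r₁ ^ 2) / 2
      - ((t₀ + t₂) / r₂ ^ 2 - (t₀ - t₁) / r₁ ^ 2) / 2,
    fun t => -(2 * (k * (t - t₀)) * (σ * (γ + k * (t - t₀) / 2))),
    isCanonicalChart_baseChart h₁ h₂, by positivity, ?_, ?_, ?_, ?_, ?_, ?_, ?_⟩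
  · refine ContDiffOn.clm_comp (ContDiffOn.add (ContDiffOn.smul (hl.inv ?_) contDiffOn_const)
      (ContDiffOn.smul hl contDiffOn_const)) contDiffOn_const
    exact fun t ht => (Real.sqrt_pos.2 (hpos t ht)).ne'
  · exact ContDiff.contDiffOn (by fun_prop)
  · exact ContDiff.contDiffOn (by fun_prop)
  · simp
  · simp
  · have hd : HasDerivAt (fun t => -(2 * (k * (t - t₀)) * (σ * (γ + k * (t - t₀) / 2))))
        (-(2 * k * (σ * γ))) t₀ := by
      have h := ((((hasDerivAt_id t₀).sub_const t₀).const_mul k).const_mul 2).mul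
        (((((((hasDerivAt_id t₀).sub_const t₀).const_mul k).mul_const (2 : ℝ)⁻¹).const_add
          γ).const_mul σ))
      simp only [id, sub_self, mul_zero, zero_mul, add_zero, mul_one] at h
      exact h.neg
    rw [hd.deriv]
    have : 0 < 2 * k * (σ * γ) := by positivity
    linarith
  · intro t ht
    have hs := Real.sqrt_pos.2 (hpos t ht)
    have hsq := Real.sq_sqrt (hpos t ht).le
    set l := √(σ * (γ + k * (t - t₀) / 2)) with hldef
    have hml : l⁻¹ * l = 1 := inv_mul_cancel₀ hs.ne'
    have hP : ∀ v w : R4, omegaStd ((hopfMap l⁻¹ l).comp swap v) ((hopfMap l⁻¹ l).comp swap w)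
        = omegaStd v w := by
      intro v w
      simp only [ContinuousLinearMap.comp_apply, omegaStd_hopfMap hml, omegaStd_swap]
    refine ⟨hP, ?_⟩
    have hτ := isSymplecticMap_linear _ hP
    have h2 := isLittleO_sub_of_isBigO (hamiltonian_expansion h₁.ne' h₂.ne' t₁ t₂ t₃ t)
      (isBigO_quartPart _ _ _ _)
    refine (hτ.isLittleO_comp h2).congr_left fun x => ?_
    simp only [Function.comp, ContinuousLinearMap.comp_apply]
    rw [← hγdef, quadPart_hopfMap hml, genS_swap, genM_swap, genN_swap, hε t]
    have hinv : (l⁻¹) ^ 2 * l ^ 2 = 1 := by rw [← mul_pow, hml, one_pow]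
    have hσl : (γ + k * (t - t₀) / 2) * (l⁻¹) ^ 2 = σ := by
      have : σ * l ^ 2 = γ + k * (t - t₀) / 2 := by
        rw [hsq]
        linear_combination (γ + k * (t - t₀) / 2) * hσ
      rw [← this]
      linear_combination σ * hinv
    linear_combination (-genM x) * hσl - 2 * k * (t - t₀) * genN x * hsq

lemma hasHopfNormalForm_hamiltonian {r₁ r₂ t₁ t₂ t₃ t₀ σ : ℝ} (h₁ : 0 < r₁) (h₂ : 0 < r₂)
    (hσ : σ ^ 2 = 1) (hγ : 0 < σ * (t₃ / (r₁ * r₂)))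
    (ht₀ : ((t₀ - t₁) / r₁ ^ 2 + (t₀ + t₂) / r₂ ^ 2) / 2 = t₃ / (r₁ * r₂)) :
    HasHopfNormalForm (r₁ ^ 2) (r₂ ^ 2) (hamiltonian 1 0 t₁ t₂ t₃ t₀) m₀
      (((t₀ + t₂) / r₂ ^ 2 - (t₀ - t₁) / r₁ ^ 2) / 2) σ
      ((t₃ / (r₁ * r₂)) ^ 2 * (t₃ / (r₁ * r₂) * (1 / r₁ ^ 2 + 1 / r₂ ^ 2) / 2
        - t₀ / (r₁ ^ 2 * r₂ ^ 2))) := by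
  have hexp := hamiltonian_expansion h₁.ne' h₂.ne' t₁ t₂ t₃ t₀
  set γ := t₃ / (r₁ * r₂)
  have hs := Real.sqrt_pos.2 hγ
  have hsq := Real.sq_sqrt hγ.le
  set l := √(σ * γ)
  have hml : l⁻¹ * l = 1 := inv_mul_cancel₀ hs.ne'
  have hL := isSymplecticMap_linear _ (omegaStd_hopfMap hml)
  obtain ⟨τ, hτ, hnf⟩ := exists_normalization hσ
    (((t₀ + t₂) / r₂ ^ 2 - (t₀ - t₁) / r₁ ^ 2) / 2)
    (l ^ 4 * (γ * (1 / r₁ ^ 2 + 1 / r₂ ^ 2) / 2 - t₀ / (r₁ ^ 2 * r₂ ^ 2)))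
    (-(t₀ / (r₁ ^ 2 * r₂ ^ 2)) / 2)
    (-(t₀ / (r₁ ^ 2 * r₂ ^ 2) + γ * (1 / r₁ ^ 2 + 1 / r₂ ^ 2) / 2) / 16 * l⁻¹ ^ 4)
    (γ * (1 / r₂ ^ 2 - 1 / r₁ ^ 2) / 4 * l ^ 2)
    (-γ * (1 / r₂ ^ 2 - 1 / r₁ ^ 2) / 16 * l⁻¹ ^ 2)
    (t₀ / (r₁ ^ 2 * r₂ ^ 2) / 4)
  have hinv : (l⁻¹) ^ 2 * l ^ 2 = 1 := by rw [← mul_pow, hml, one_pow]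
  have hσl : γ * (l⁻¹) ^ 2 = σ := by
    have : σ * l ^ 2 = γ := by
      rw [hsq]
      linear_combination γ * hσ
    rw [← this]
    linear_combination σ * hinv
  -- This puts the coefficient of `M²` in closed form, free of the square root.
  have hl4 : l ^ 4 = γ ^ 2 := by
    linear_combination (l ^ 2 + σ * γ) * hsq + γ ^ 2 * hσ
  rw [hl4] at hnf
  refine ⟨_, _, _, _, ((isCanonicalChart_baseChart h₁ h₂).comp hL).comp hτ,
    hnf (fun x => hamiltonian 1 0 t₁ t₂ t₃ t₀ (baseChart r₁ r₂ (hopfMap l⁻¹ l x))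
      - hamiltonian 1 0 t₁ t₂ t₃ t₀ m₀) ?_⟩
  refine (hL.isLittleO_comp hexp).congr_left fun x => ?_
  simp only [Function.comp]
  rw [quadPart_hopfMap hml, quartPart_hopfMap hml, ht₀, hl4]
  linear_combination (-genN x) * hσl


lemma isSubcriticalHHB_hamiltonian {r₁ r₂ t₁ t₂ t₃ : ℝ} (h₁ : 0 < r₁) (h₂ : 0 < r₂)
    (hα : (t₁ + t₂) * (r₁ * r₂) + t₃ * (r₁ ^ 2 - r₂ ^ 2) ≠ 0) (ht₃ : t₃ ≠ 0)
    (ha : t₃ * ((r₁ ^ 2 - r₂ ^ 2) ^ 2 * t₃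
      + 2 * (r₁ * r₂) * (r₁ ^ 2 * t₂ - r₂ ^ 2 * t₁)) < 0) :
    IsSubcriticalHHB (r₁ ^ 2) (r₂ ^ 2) (fun t => hamiltonian 1 0 t₁ t₂ t₃ t) m₀
      ((t₁ * r₂ ^ 2 - t₂ * r₁ ^ 2 + 2 * t₃ * (r₁ * r₂)) / (r₁ ^ 2 + r₂ ^ 2)) := by
  set t₀ := (t₁ * r₂ ^ 2 - t₂ * r₁ ^ 2 + 2 * t₃ * (r₁ * r₂)) / (r₁ ^ 2 + r₂ ^ 2) with ht₀
  have hr : r₁ ^ 2 + r₂ ^ 2 ≠ 0 := by positivity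
  have hres : ((t₀ - t₁) / r₁ ^ 2 + (t₀ + t₂) / r₂ ^ 2) / 2 = t₃ / (r₁ * r₂) := by
    rw [ht₀]
    field_simp
    ring
  -- `σ` is the sign of `t₃`.
  obtain ⟨σ, hσ, hσ2, hσt⟩ : ∃ σ : ℝ, (σ = 1 ∨ σ = -1) ∧ σ ^ 2 = 1 ∧ 0 < σ * t₃ := by
    rcases lt_or_gt_of_ne ht₃ with h | h
    · exact ⟨-1, Or.inr rfl, by norm_num, by linarith⟩
    · exact ⟨1, Or.inl rfl, by norm_num, by linarith⟩
  have hγ : 0 < σ * (t₃ / (r₁ * r₂)) := by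
    rw [← mul_div_assoc]
    positivity
  refine ⟨_, σ, _, ?_, hσ, isLinearHHB_hamiltonian h₁ h₂ hσ2 hγ hres,
    hasHopfNormalForm_hamiltonian h₁ h₂ hσ2 hγ hres, ?_⟩
  · have : ((t₀ + t₂) / r₂ ^ 2 - (t₀ - t₁) / r₁ ^ 2) / 2
        = ((t₁ + t₂) * (r₁ * r₂) + t₃ * (r₁ ^ 2 - r₂ ^ 2))
          / (r₁ * r₂ * (r₁ ^ 2 + r₂ ^ 2)) := by
      rw [ht₀]
      field_simp
      ring
    rw [this]
    exact div_ne_zero hα (by positivity)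
  · have : σ * ((t₃ / (r₁ * r₂)) ^ 2 * (t₃ / (r₁ * r₂) * (1 / r₁ ^ 2 + 1 / r₂ ^ 2) / 2
        - t₀ / (r₁ ^ 2 * r₂ ^ 2))) = σ * t₃ * (t₃ * ((r₁ ^ 2 - r₂ ^ 2) ^ 2 * t₃
          + 2 * (r₁ * r₂) * (r₁ ^ 2 * t₂ - r₂ ^ 2 * t₁)))
          / (2 * (r₁ * r₂) ^ 5 * (r₁ ^ 2 + r₂ ^ 2)) := by
      rw [ht₀]
      field_simp
      ring
    rw [this]
    exact div_neg_of_neg_of_pos (mul_neg_of_pos_of_neg hσt ha) (by positivity)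

end Gaudin

end

theorem corollary5p1 (R₁ R₂ t₁ t₂ t₃ : ℝ) (hR₁ : 0 < R₁) (hR₂ : 0 < R₂)
    (hα : (t₁ + t₂) * √(R₁ * R₂) + t₃ * (R₁ - R₂) ≠ 0) :
    (((R₁ = R₂ ∧ ((t₁ < t₂ ∧ t₃ < 0) ∨ (t₁ > t₂ ∧ t₃ > 0))) ∨
        ((R₁ - R₂) ^ 2 * t₃ > -(2 * √(R₁ * R₂) * (R₁ * t₂ - R₂ * t₁)) ∧ t₃ < 0) ∨
        ((R₁ - R₂) ^ 2 * t₃ < -(2 * √(R₁ * R₂) * (R₁ * t₂ - R₂ * t₁)) ∧ t₃ > 0)) →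
      Gaudin.IsSubcriticalHHB R₁ R₂ (fun t₄ => Gaudin.hamiltonian 1 0 t₁ t₂ t₃ t₄) Gaudin.m₀
        (Gaudin.t4plus R₁ R₂ 1 t₁ t₂ t₃)) ∧
    (((R₁ = R₂ ∧ ((t₁ < t₂ ∧ t₃ < 0) ∨ (t₁ > t₂ ∧ t₃ > 0))) ∨
        ((R₁ - R₂) ^ 2 * t₃ > -(2 * √(R₁ * R₂) * (R₁ * t₂ - R₂ * t₁)) ∧ t₃ < 0) ∨
        ((R₁ - R₂) ^ 2 * t₃ < -(2 * √(R₁ * R₂) * (R₁ * t₂ - R₂ * t₁)) ∧ t₃ > 0)) ↔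
      (t₃ ≠ 0 ∧ Gaudin.a₃ R₁ R₂ 1 0 t₁ t₂ t₃ < 0)) := by
  -- Writing the `Rᵢ` as squares makes `√(R₁R₂)` the monomial `r₁r₂`, so all later identities are
  -- rational.
  obtain ⟨r₁, h₁, rfl⟩ : ∃ r, 0 < r ∧ r ^ 2 = R₁ := ⟨√R₁, Real.sqrt_pos.2 hR₁, Real.sq_sqrt hR₁.le⟩
  obtain ⟨r₂, h₂, rfl⟩ : ∃ r, 0 < r ∧ r ^ 2 = R₂ := ⟨√R₂, Real.sqrt_pos.2 hR₂, Real.sq_sqrt hR₂.le⟩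
  have hs : √(r₁ ^ 2 * r₂ ^ 2) = r₁ * r₂ := by
    rw [← mul_pow, Real.sqrt_sq (by positivity)]
  -- All three conditions express one sign. Condition (i) is the case `R₁ = R₂` of (ii) and (iii),
  -- so the converse only has to produce these two.
  have hcond : ((r₁ ^ 2 = r₂ ^ 2 ∧ ((t₁ < t₂ ∧ t₃ < 0) ∨ (t₁ > t₂ ∧ t₃ > 0))) ∨
      ((r₁ ^ 2 - r₂ ^ 2) ^ 2 * t₃ > -(2 * (r₁ * r₂) * (r₁ ^ 2 * t₂ - r₂ ^ 2 * t₁)) ∧ t₃ < 0) ∨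
      ((r₁ ^ 2 - r₂ ^ 2) ^ 2 * t₃ < -(2 * (r₁ * r₂) * (r₁ ^ 2 * t₂ - r₂ ^ 2 * t₁)) ∧ t₃ > 0)) ↔
      t₃ * ((r₁ ^ 2 - r₂ ^ 2) ^ 2 * t₃
        + 2 * (r₁ * r₂) * (r₁ ^ 2 * t₂ - r₂ ^ 2 * t₁)) < 0 := by
    rw [mul_neg_iff]
    constructor
    · rintro (⟨he, h⟩ | ⟨h, h3⟩ | ⟨h, h3⟩)
      · have e : (r₁ ^ 2 - r₂ ^ 2) ^ 2 * t₃ + 2 * (r₁ * r₂) * (r₁ ^ 2 * t₂ - r₂ ^ 2 * t₁)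
            = 2 * (r₁ * r₂) * r₂ ^ 2 * (t₂ - t₁) := by
          rw [he]
          ring
        rw [e]
        rcases h with ⟨h, h3⟩ | ⟨h, h3⟩
        · exact Or.inr ⟨h3, mul_pos (by positivity) (by linarith)⟩
        · exact Or.inl ⟨h3, mul_neg_of_pos_of_neg (by positivity) (by linarith)⟩
      · exact Or.inr ⟨h3, by linarith⟩
      · exact Or.inl ⟨h3, by linarith⟩
    · rintro (⟨h3, h⟩ | ⟨h3, h⟩)
      · exact Or.inr (Or.inr ⟨by linarith, h3⟩)
      · exact Or.inr (Or.inl ⟨by linarith, h3⟩)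
  rw [hs] at hα ⊢
  rw [hcond]
  refine ⟨fun h => ?_, ?_⟩
  · have ht₃ : t₃ ≠ 0 := by
      rintro rfl
      simp at h
    have := Gaudin.isSubcriticalHHB_hamiltonian h₁ h₂ hα ht₃ h
    rwa [Gaudin.t4plus, hs, one_mul]
  -- Expanding the fraction by `t₃` makes the denominator positive and the numerator the polynomial
  -- of `hcond`.
  · have e : t₃ ≠ 0 → Gaudin.a₃ (r₁ ^ 2) (r₂ ^ 2) 1 0 t₁ t₂ t₃
        = t₃ * ((r₁ ^ 2 - r₂ ^ 2) ^ 2 * t₃ + 2 * (r₁ * r₂) * (r₁ ^ 2 * t₂ - r₂ ^ 2 * t₁))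
          / (8 * (r₁ * r₂) ^ 2 * (r₁ ^ 2 + r₂ ^ 2) * t₃ ^ 2) := by
      intro ht₃
      have hr : r₁ ^ 2 + r₂ ^ 2 ≠ 0 := by positivity
      rw [Gaudin.a₃, hs]
      field_simp
      ring
    constructor
    · intro h
      have ht₃ : t₃ ≠ 0 := by
        rintro rfl
        simp at h
      refine ⟨ht₃, ?_⟩
      rw [e ht₃]
      exact div_neg_of_neg_of_pos h (by positivity)
    · rintro ⟨ht₃, h⟩
      rw [e ht₃] at h
      by_contra! hn
      exact h.not_ge (div_nonneg hn (by positivity))
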